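/- Let $d\in\mathbb N$, $\mu\in\mathbb R^d$, let $\Sigma\in\mathbb R^{d\times d}$ be symmetric positive definite, let $B\subseteq\mathbb R^d$ be closed, convex, absorbing and origin-symmetric, and let $\beta\ge 0$; if $\beta=0$, assume that $B$ is bounded. Put $N(x)=x+\beta B$, $\|y\|_\Sigma=\sqrt{y^\top\Sigma^{-1}y}$, $\|z\|_B=\inf\{r>0: z\in rB\}$, and for $p\in\{\Sigma,B\}$ let $\|w\|_{p*}=\sup\{w^\top z:\|z\|_p\le 1\}\in[0,\infty]$. Let $Q$ be the complementary cumulative distribution function of $\mathcal N(0,1)$, and let $\alpha^*=\alpha^*(\beta,\mu)$ be the value of the convex program $$\min\ \alpha\quad\text{over } (z,y,\alpha)\in\mathbb R^{d}\times\mathbb R^d\times\mathbb R\quad\text{subject to}\quad \|y\|_\Sigma\le\alpha,\quad \|z\|_B\le\beta,\quad z+y=\mu .$$ 1. The minimum $\alpha^*$ is attained. 2. The adversarial transport cost between the two classes, i.e. the infimum of $\Pr[N(X)\cap N(X')=\varnothing]$ over all couplings $(X,X')$ of $\mathcal N(\mu,\Sigma)$ and $\mathcal N(-\mu,\Sigma)$,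 equals $1-2Q(\alpha^*)$. 3. Let $Y$ be uniform on $\{1,-1\}$ and let $X$ given $Y=y$ have law $\mathcal N(y\mu,\Sigma)$. Over all measurable $h:\mathbb R^d\to\{1,-1\}$, the adversarial loss $L(h)=\mathbb E\big[\max_{\tilde x\in N(X)}\mathbf 1[h(\tilde x)\ne Y]\big]$ has the minimum $Q(\alpha^*)$, and it is attained by linear classifiers: call $w\in\mathbb R^d$ a dual certificate if there are $y,z\in\mathbb R^d$ and $\gamma\in\mathbb R$ with $y+z=\mu$, $\|y\|_\Sigma=\alpha^*$, $\|z\|_B\le\beta$, $\|w\|_{\Sigma*}\le 1$, $\|w\|_{B*}=\gamma$, $w^\top y=\alpha^*$ and $w^\top z=\beta\gamma$. Then dual certificates exist, and for every dual certificate $w$ the classifier $h(x)=\operatorname{sgn}(w^\top x)$ (with either of the conventions $\operatorname{sgn}(0)=1$, $\operatorname{sgn}(0)=-1$) satisfies $L(h)=Q(\alpha^*)$. 4. If $d\ge1$ and $\beta\le\|\mu\|_B$, then there are $y,z,w\in\mathbb R^d$ and $\gamma\in\mathbb R$ with $y+z=\mu$, $\|y\|_\Sigma=\alpha^*$, $\|z\|_B=\beta$,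 $\|w\|_{\Sigma*}=1$, $\|w\|_{B*}=\gamma$, $w^\top y=\alpha^*$ and $w^\top z=\beta\gamma$; in particular such a $w$ is a dual certificate. -/

import Mathlib

open MeasureTheory ProbabilityTheory Matrix
open scoped ENNReal Pointwise

noncomputable section

/-! ### Optimal transport with adversarial costs -/

/-- Couplings of two measures: measures on the product with the two given marginals. -/
def couplings {X Y : Type*} [MeasurableSpace X] [MeasurableSpace Y]
    (P : Measure X) (Q : Measure Y) : Set (Measure (X × Y)) :=
  {π | π.map Prod.fst = P ∧ π.map Prod.snd = Q}

/-- Optimal transport cost for a nonnegative cost function `c`. -/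
def transportCost {X Y : Type*} [MeasurableSpace X] [MeasurableSpace Y]
    (c : X → Y → ℝ≥0∞) (P : Measure X) (Q : Measure Y) : ℝ≥0∞ :=
  ⨅ π ∈ couplings P Q, ∫⁻ p, c p.1 p.2 ∂π

/-- Composition of cost functions. -/
def costComp {X Y Z : Type*} (c : X → Y → ℝ≥0∞) (c' : Y → Z → ℝ≥0∞) : X → Z → ℝ≥0∞ :=
  fun x z => ⨅ y, c x y + c' y z

open Classical in
/-- The cost function of the neighborhood function `N`: `1` if `x'` is not in `N x`, else `0`. -/
def advCost {X X' : Type*} (N : X → Set X') : X → X' → ℝ≥0∞ :=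
  fun x x' => if x' ∈ N x then 0 else 1

/-- The adversarial transport cost: the optimal transport cost for the composition of the
neighborhood cost function with its transpose. -/
def advTransportCost {X X' : Type*} [MeasurableSpace X] (N : X → Set X') (P Q : Measure X) :
    ℝ≥0∞ :=
  transportCost (costComp (advCost N) (fun x' x => advCost N x x')) P Q

/-! ### Adversarial classification, with labels in `{1, -1} = ℤˣ` -/

/-- The 0-1 loss. -/
def zeroOneLoss (a b : ℤˣ) : ℝ≥0∞ := if a = b then 0 else 1

/-- Error rate of the hypothesis `h` under the law `P` of labeled examples, against an adversary
constrained by `N`. -/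
def advLoss {X X' : Type*} [MeasurableSpace X] (N : X → Set X') (P : Measure (X × ℤˣ))
    (h : X' → ℤˣ) : ℝ≥0∞ :=
  ∫⁻ p, ⨆ x' ∈ N p.1, zeroOneLoss (h x') p.2 ∂P

/-- The law of `(X, Y)` with `Y` uniform on `{1, -1}` and `X` given `Y = y` distributed as
the Gaussian with mean `y μ` and covariance matrix `S`. -/
def gaussianMixture {d : ℕ} (μ : EuclideanSpace ℝ (Fin d)) (S : Matrix (Fin d) (Fin d) ℝ) :
    Measure (EuclideanSpace ℝ (Fin d) × ℤˣ) :=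
  (2⁻¹ : ℝ≥0∞) • (multivariateGaussian μ S).map (fun x => (x, (1 : ℤˣ))) +
    (2⁻¹ : ℝ≥0∞) • (multivariateGaussian (-μ) S).map (fun x => (x, (-1 : ℤˣ)))

/-- The neighborhood function `N x = x + β B`. -/
def ballNbhd {d : ℕ} (B : Set (EuclideanSpace ℝ (Fin d))) (β : ℝ) :
    EuclideanSpace ℝ (Fin d) → Set (EuclideanSpace ℝ (Fin d)) :=
  fun x => (fun z => x + z) '' (β • B)

/-- The linear classifier `sgn (wᵀ x)`, with the convention `sgn 0 = s`. -/
def linearClassifier {d : ℕ} (s : ℤˣ) (w : EuclideanSpace ℝ (Fin d)) :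
    EuclideanSpace ℝ (Fin d) → ℤˣ :=
  fun x => if 0 < inner ℝ w x then 1 else if inner ℝ w x < 0 then -1 else s

/-! ### The convex program -/

/-- Complementary cumulative distribution function of the standard normal law. -/
def gaussianQ (t : ℝ) : ℝ := (gaussianReal 0 1).real (Set.Ioi t)

/-- The norm `√(yᵀ S⁻¹ y)`. -/
def covNorm {d : ℕ} (S : Matrix (Fin d) (Fin d) ℝ) (y : EuclideanSpace ℝ (Fin d)) : ℝ :=
  √(y.ofLp ⬝ᵥ (S⁻¹ *ᵥ y.ofLp))

/-- The dual (semi)norm of `p`, the supremum of `wᵀ z` over the unit ball of `p`; it is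
extended-real valued, since the unit ball of a seminorm can be unbounded. -/
def dualNorm {d : ℕ} (p : EuclideanSpace ℝ (Fin d) → ℝ) (w : EuclideanSpace ℝ (Fin d)) : EReal :=
  ⨆ z ∈ {z | p z ≤ 1}, ((inner ℝ w z : ℝ) : EReal)

/-- The objective values `α` of the feasible points `(z, y, α)` of the program
`min α` s.t. `‖y‖_S ≤ α`, `‖z‖_B ≤ β`, `z + y = μ`; here `‖z‖_B` is the gauge of `B`. -/
def programValues {d : ℕ} (S : Matrix (Fin d) (Fin d) ℝ) (B : Set (EuclideanSpace ℝ (Fin d)))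
    (β : ℝ) (μ : EuclideanSpace ℝ (Fin d)) : Set ℝ :=
  {α | ∃ z y : EuclideanSpace ℝ (Fin d), covNorm S y ≤ α ∧ gauge B z ≤ β ∧ z + y = μ}

/-- The value of the program. -/
def alphaStar {d : ℕ} (S : Matrix (Fin d) (Fin d) ℝ) (B : Set (EuclideanSpace ℝ (Fin d)))
    (β : ℝ) (μ : EuclideanSpace ℝ (Fin d)) : ℝ :=
  sInf (programValues S B β μ)

/-- `w` is a dual certificate of the program: together with a feasible pair `(y, z)` of optimal
value it satisfies dual feasibility and complementary slackness. -/
def IsDualCertificate {d : ℕ} (S : Matrix (Fin d) (Fin d) ℝ)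
    (B : Set (EuclideanSpace ℝ (Fin d))) (β : ℝ) (μ w : EuclideanSpace ℝ (Fin d)) : Prop :=
  ∃ (y z : EuclideanSpace ℝ (Fin d)) (γ : ℝ), y + z = μ ∧
    covNorm S y = alphaStar S B β μ ∧ gauge B z ≤ β ∧
    dualNorm (covNorm S) w ≤ 1 ∧ dualNorm (gauge B) w = (γ : EReal) ∧
    inner ℝ w y = alphaStar S B β μ ∧ inner ℝ w z = β * γ

end

/-! ### The gauge of a convex absorbing set in finite dimension -/

section Gauge

variable {E : Type*} [NormedAddCommGroup E] [NormedSpace ℝ E] {B : Set E}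

/-! Let `T` be the square root of `S`. Since `covNorm S y = ‖T⁻¹ y‖`, the program is the metric
projection of `T⁻¹ μ` onto the closed convex set `T⁻¹ {gauge B ≤ β}`. The residual gives an optimal
splitting `μ = y + z`, and the variational inequality of the projection says that `w = S⁻¹ y / α*`
is maximised over `β B` at `z`, which is the dual certificate (for `α* = 0`, take `w = 0`).

The splitting bounds transport cost above and loss below. Translating the two laws by `∓z` leaves
Gaussians with means `±y`, which have a coupling that differs with probability at most `1 - 2Q(α*)`
(`exists_coupling_multivariateGaussian`). Where the translated points agree, the neighborhoods meet,
and no classifier is right for both labels.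

The certificate gives the opposite bounds. With `c = βγ`, the maximum of `w` on `β B`, the
neighborhood of `x` lies in `{w > 0}` once `⟪w, x⟫ > c`, and symmetrically for the other class. Each
condition fails with probability at most `Q(α*)`, because `⟪w, μ⟫ = α* + c` and `‖T w‖ ≤ 1`
(`multivariateGaussian_halfSpace_le`). -/

theorem convexOn_gauge (hc : Convex ℝ B) (ha : Absorbent ℝ B) :
    ConvexOn ℝ Set.univ (gauge B) := by
  refine ⟨convex_univ, fun x _ y _ a b hap hbp _ => ?_⟩
  refine (gauge_add_le hc ha _ _).trans_eq ?_
  rw [gauge_smul_of_nonneg hap, gauge_smul_of_nonneg hbp]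

theorem continuous_gauge_of_absorbent [FiniteDimensional ℝ E] (hc : Convex ℝ B)
    (ha : Absorbent ℝ B) : Continuous (gauge B) :=
  (convexOn_gauge hc ha).locallyLipschitz.continuous

/-- For `β > 0` this is closedness of `B` after rescaling. For `β = 0` the right side is `{0}`,
while the gauge also vanishes along every ray contained in `B`; boundedness excludes these. -/
theorem gauge_le_iff_mem_smul [FiniteDimensional ℝ E] (hcl : IsClosed B) (hc : Convex ℝ B)
    (ha : Absorbent ℝ B) {β : ℝ} (hβ : 0 ≤ β) (hb : β = 0 → Bornology.IsBounded B) {x : E} :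
    gauge B x ≤ β ↔ x ∈ β • B := by
  refine ⟨fun h => ?_, gauge_le_of_mem hβ⟩
  have h0 : (0 : E) ∈ B := ha.zero_mem
  rcases hβ.eq_or_lt with rfl | hpos
  · have hx : gauge B x = 0 := le_antisymm h (gauge_nonneg x)
    rw [gauge_eq_zero ha ((NormedSpace.isVonNBounded_iff ℝ).2 (hb rfl))] at hx
    subst hx
    exact ⟨0, h0, by simp⟩
  · rw [Set.mem_smul_set_iff_inv_smul_mem₀ hpos.ne', ← hcl.closure_eq]
    refine mem_closure_of_gauge_le_one hc h0 ha ?_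
    rw [gauge_smul_of_nonneg (inv_nonneg.2 hβ), smul_eq_mul, inv_mul_le_iff₀ hpos, mul_one]
    exact h

end Gauge

variable {d : ℕ}

/-! ### Dual norms -/

theorem dualNorm_eq_of_isMaxOn {p : EuclideanSpace ℝ (Fin d) → ℝ} {w z : EuclideanSpace ℝ (Fin d)}
    (hz : p z ≤ 1) (hmax : ∀ x, p x ≤ 1 → inner ℝ w x ≤ inner ℝ w z) :
    dualNorm p w = ((inner ℝ w z : ℝ) : EReal) := by
  refine le_antisymm (iSup₂_le fun x hx => EReal.coe_le_coe_iff.2 (hmax x hx)) ?_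
  exact le_iSup₂_of_le z hz le_rfl

theorem inner_le_of_dualNorm_eq {p : EuclideanSpace ℝ (Fin d) → ℝ}
    {w z : EuclideanSpace ℝ (Fin d)} {γ : ℝ} (h : dualNorm p w = γ) (hz : p z ≤ 1) :
    inner ℝ w z ≤ γ := by
  rw [← EReal.coe_le_coe_iff, ← h]
  exact le_iSup₂_of_le (f := fun z (_ : z ∈ {z | p z ≤ 1}) => ((inner ℝ w z : ℝ) : EReal))
    z hz le_rfl

section DualGauge

variable {B : Set (EuclideanSpace ℝ (Fin d))} {β : ℝ} {w z : EuclideanSpace ℝ (Fin d)}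

theorem eq_zero_of_gauge_le_zero (ha : Absorbent ℝ B) (hb : Bornology.IsBounded B)
    (h : gauge B z ≤ 0) : z = 0 :=
  (gauge_eq_zero ha ((NormedSpace.isVonNBounded_iff ℝ).2 hb)).1 (le_antisymm h (gauge_nonneg z))

theorem inner_le_mul_of_dualNorm_gauge_eq (ha : Absorbent ℝ B) (hβ : 0 ≤ β)
    (hb : β = 0 → Bornology.IsBounded B) {γ : ℝ} (h : dualNorm (gauge B) w = γ)
    (hz : gauge B z ≤ β) : inner ℝ w z ≤ β * γ := by
  rcases hβ.eq_or_lt with rfl | hpos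
  · simp [eq_zero_of_gauge_le_zero ha (hb rfl) hz]
  · have : inner ℝ w (β⁻¹ • z) ≤ γ := by
      refine inner_le_of_dualNorm_eq h ?_
      rw [gauge_smul_of_nonneg (inv_nonneg.2 hβ), smul_eq_mul, inv_mul_le_iff₀ hpos, mul_one]
      exact hz
    rwa [inner_smul_right, inv_mul_le_iff₀ hpos] at this

theorem exists_dualNorm_gauge_eq_of_isMaxOn (hcl : IsClosed B) (hc : Convex ℝ B)
    (ha : Absorbent ℝ B) (hβ : 0 ≤ β) (hb : β = 0 → Bornology.IsBounded B)
    (hz : gauge B z ≤ β) (hmax : ∀ x, gauge B x ≤ β → inner ℝ w x ≤ inner ℝ w z) :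
    ∃ γ : ℝ, dualNorm (gauge B) w = γ ∧ inner ℝ w z = β * γ := by
  rcases hβ.eq_or_lt with rfl | hpos
  -- Maximality over the zero ball carries no information on `w`, so finiteness of the dual norm
  -- comes from compactness of `B`.
  · have hcomp : IsCompact B := Metric.isCompact_of_isClosed_isBounded hcl (hb rfl)
    obtain ⟨u, hu, humax⟩ := hcomp.exists_isMaxOn ⟨0, ha.zero_mem⟩
      (f := fun x => inner ℝ w x) (by fun_prop)
    refine ⟨_, dualNorm_eq_of_isMaxOn (gauge_le_one_of_mem hu) fun x hx => humax ?_, ?_⟩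
    · rwa [gauge_le_iff_mem_smul hcl hc ha zero_le_one (by simp), one_smul] at hx
    · simp [eq_zero_of_gauge_le_zero ha (hb rfl) hz]
  · have hz' : gauge B (β⁻¹ • z) ≤ 1 := by
      rw [gauge_smul_of_nonneg (inv_nonneg.2 hβ), smul_eq_mul, inv_mul_le_iff₀ hpos, mul_one]
      exact hz
    refine ⟨_, dualNorm_eq_of_isMaxOn hz' fun x hx => ?_, ?_⟩
    · have := hmax (β • x) (by
        rw [gauge_smul_of_nonneg hβ, smul_eq_mul]
        nlinarith)
      rw [inner_smul_right] at this ⊢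
      rwa [le_inv_mul_iff₀ hpos]
    · rw [inner_smul_right, mul_inv_cancel_left₀ hpos.ne']

end DualGauge

/-! ### The square root of the covariance matrix -/

section Sqrt

variable {S : Matrix (Fin d) (Fin d) ℝ}

open scoped MatrixOrder in
-- Self-adjointness, the norm identity and the image of the standard Gaussian are all that is used
-- about `S` from here on.
theorem exists_sqrt_equiv (hS : S.PosDef) :
    ∃ T : EuclideanSpace ℝ (Fin d) ≃L[ℝ] EuclideanSpace ℝ (Fin d),
      (∀ x y, inner ℝ (T x) y = inner ℝ x (T y)) ∧
      (∀ y, covNorm S y = ‖T.symm y‖) ∧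
      ∀ m, multivariateGaussian m S =
        (stdGaussian (EuclideanSpace ℝ (Fin d))).map (fun x => m + T x) := by
  set R := CFC.sqrt S with hR
  have hRR : R * R = S := CFC.sqrt_mul_sqrt_self _ hS.posSemidef.nonneg
  have hdet : IsUnit R.det := by
    have h := hS.det_pos.ne'
    rw [← hRR, Matrix.det_mul] at h
    exact (left_ne_zero_of_mul h).isUnit
  have hsym : Rᵀ = R := by
    have := (CFC.sqrt_nonneg S).isSelfAdjoint
    simpa [IsSelfAdjoint, Matrix.star_eq_conjTranspose] using this
  have h1 : R * R⁻¹ = 1 := Matrix.mul_nonsing_inv _ hdet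
  have h2 : R⁻¹ * R = 1 := Matrix.nonsing_inv_mul _ hdet
  have e1 : toEuclideanCLM (𝕜 := ℝ) R * toEuclideanCLM (𝕜 := ℝ) R⁻¹ = 1 := by
    rw [← map_mul, h1, map_one]
  have e2 : toEuclideanCLM (𝕜 := ℝ) R⁻¹ * toEuclideanCLM (𝕜 := ℝ) R = 1 := by
    rw [← map_mul, h2, map_one]
  let T : EuclideanSpace ℝ (Fin d) ≃L[ℝ] EuclideanSpace ℝ (Fin d) :=
    ContinuousLinearEquiv.equivOfInverse (toEuclideanCLM (𝕜 := ℝ) R)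
      (toEuclideanCLM (𝕜 := ℝ) R⁻¹)
      (fun x => by simpa using DFunLike.congr_fun e2 x)
      (fun x => by simpa using DFunLike.congr_fun e1 x)
  refine ⟨T, fun x y => ?_, fun y => ?_, fun m => rfl⟩
  · change inner ℝ (toEuclideanCLM (𝕜 := ℝ) R x) y = inner ℝ x (toEuclideanCLM (𝕜 := ℝ) R y)
    rw [real_inner_comm, inner_toEuclideanCLM, inner_toEuclideanCLM]
    rw [Matrix.dotProduct_mulVec, ← Matrix.mulVec_transpose, hsym, dotProduct_comm]
  · change _ = ‖toEuclideanCLM (𝕜 := ℝ) R⁻¹ y‖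
    rw [covNorm, norm_eq_sqrt_real_inner]
    congr 1
    rw [inner_toEuclideanCLM, ← hRR, Matrix.mul_inv_rev, ← Matrix.mulVec_mulVec]
    have hsym' : R⁻¹ᵀ = R⁻¹ := by rw [Matrix.transpose_nonsing_inv, hsym]
    rw [Matrix.dotProduct_mulVec, ← Matrix.mulVec_transpose, hsym']
    rfl

end Sqrt

/-! ### The convex program -/

section Program

variable {d : ℕ} {S : Matrix (Fin d) (Fin d) ℝ} {B : Set (EuclideanSpace ℝ (Fin d))} {β : ℝ}
  {μ : EuclideanSpace ℝ (Fin d)} {T : EuclideanSpace ℝ (Fin d) ≃L[ℝ] EuclideanSpace ℝ (Fin d)}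

theorem dualNorm_covNorm (hT : ∀ x y, inner ℝ (T x) y = inner ℝ x (T y))
    (hST : ∀ y, covNorm S y = ‖T.symm y‖) (w : EuclideanSpace ℝ (Fin d)) :
    dualNorm (covNorm S) w = (‖T w‖ : EReal) := by
  have hin : ∀ z, inner ℝ w z = inner ℝ (T w) (T.symm z) := fun z => by
    rw [hT, T.apply_symm_apply]
  -- The equality case of Cauchy–Schwarz. If `T w = 0`, the convention `0⁻¹ = 0` makes the witness
  -- `0`, which still works.
  have hval : inner ℝ w (T (‖T w‖⁻¹ • T w)) = ‖T w‖ := by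
    rw [hin, T.symm_apply_apply, inner_smul_right, real_inner_self_eq_norm_sq]
    by_cases h : ‖T w‖ = 0
    · simp [h]
    · field_simp
  rw [dualNorm_eq_of_isMaxOn (z := T (‖T w‖⁻¹ • T w)) ?_ ?_, hval]
  · rw [hST, T.symm_apply_apply, norm_smul, norm_inv, norm_norm]
    exact inv_mul_le_one
  · intro x hx
    rw [hval, hin]
    rw [hST] at hx
    exact (real_inner_le_norm _ _).trans (mul_le_of_le_one_right (norm_nonneg _) hx)

/-- In the coordinates `u = T⁻¹ z` this is projection onto a closed convex set; the last inequality
is the obtuse-angle criterion for the projection `v`. -/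
theorem isLeast_alphaStar_and_exists_optimal (hST : ∀ y, covNorm S y = ‖T.symm y‖)
    (hc : Convex ℝ B) (ha : Absorbent ℝ B) (hβ : 0 ≤ β) :
    IsLeast (programValues S B β μ) (alphaStar S B β μ) ∧
    ∃ y z, y + z = μ ∧ covNorm S y = alphaStar S B β μ ∧ gauge B z ≤ β ∧
      ∀ x, gauge B x ≤ β → inner ℝ (T.symm y) (T.symm (x - z)) ≤ 0 := by
  set K : Set (EuclideanSpace ℝ (Fin d)) := {u | gauge B (T u) ≤ β} with hK
  have hKcl : IsClosed K :=
    isClosed_le ((continuous_gauge_of_absorbent hc ha).comp T.continuous) continuous_const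
  have hKconv : Convex ℝ K := by
    have := ((convexOn_gauge hc ha).convex_le β).linear_preimage
      (T : EuclideanSpace ℝ (Fin d) →ₗ[ℝ] EuclideanSpace ℝ (Fin d))
    simpa [hK, Set.preimage] using this
  have hKne : K.Nonempty := ⟨0, by simp [hK, hβ]⟩
  obtain ⟨v, hv, hmin⟩ := exists_norm_eq_iInf_of_complete_convex hKne hKcl.isComplete hKconv
    (T.symm μ)
  have hvar := (norm_eq_iInf_iff_real_inner_le_zero hKconv hv).1 hmin
  have hle : ∀ u ∈ K, ‖T.symm μ - v‖ ≤ ‖T.symm μ - u‖ := by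
    intro u hu
    rw [hmin]
    exact ciInf_le ⟨0, Set.forall_mem_range.2 fun _ => norm_nonneg _⟩ (⟨u, hu⟩ : K)
  have hy : covNorm S (μ - T v) = ‖T.symm μ - v‖ := by
    rw [hST, map_sub, T.symm_apply_apply]
  have hleast : IsLeast (programValues S B β μ) ‖T.symm μ - v‖ := by
    refine ⟨⟨T v, μ - T v, hy.le, hv, by abel⟩, ?_⟩
    rintro α ⟨z, y, hyα, hz, hzy⟩
    refine le_trans (hle (T.symm z) ?_) ?_
    · simpa [hK] using hz
    · rw [← map_sub, ← hST, ← hzy, add_sub_cancel_left]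
      exact hyα
  have heq : alphaStar S B β μ = ‖T.symm μ - v‖ := hleast.csInf_eq
  rw [heq]
  refine ⟨hleast, μ - T v, T v, by abel, hy, hv, fun x hx => ?_⟩
  have := hvar (T.symm x) (by simpa [hK] using hx)
  simpa [map_sub] using this

/-- The optimality conditions of the program, with equality in all the constraints but the
one on `z`. -/
theorem exists_certificate_of_alphaStar_pos (hT : ∀ x y, inner ℝ (T x) y = inner ℝ x (T y))
    (hST : ∀ y, covNorm S y = ‖T.symm y‖) (hcl : IsClosed B) (hc : Convex ℝ B)
    (ha : Absorbent ℝ B) (hβ : 0 ≤ β) (hb : β = 0 → Bornology.IsBounded B)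
    (hα : 0 < alphaStar S B β μ) :
    ∃ (y z w : EuclideanSpace ℝ (Fin d)) (γ : ℝ), y + z = μ ∧
      covNorm S y = alphaStar S B β μ ∧ gauge B z ≤ β ∧
      dualNorm (covNorm S) w = 1 ∧ dualNorm (gauge B) w = (γ : EReal) ∧
      inner ℝ w y = alphaStar S B β μ ∧ inner ℝ w z = β * γ := by
  obtain ⟨y, z, hyz, hy, hz, hvar⟩ :=
    (isLeast_alphaStar_and_exists_optimal (μ := μ) hST hc ha hβ).2
  set α := alphaStar S B β μ
  -- The certificate is `α⁻¹ S⁻¹ y`: pairing with it is the `S⁻¹` inner product with `y`, so the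
  -- variational inequality makes `z` its maximiser, and the factor gives `‖T w‖ = 1`.
  have hin : ∀ x, inner ℝ (α⁻¹ • T.symm (T.symm y)) x = α⁻¹ * inner ℝ (T.symm y) (T.symm x) := by
    intro x
    rw [real_inner_smul_left]
    congr 1
    conv_lhs => rw [← T.apply_symm_apply x]
    rw [← hT, T.apply_symm_apply]
  obtain ⟨γ, hγ, hzγ⟩ := exists_dualNorm_gauge_eq_of_isMaxOn (w := α⁻¹ • T.symm (T.symm y))
    hcl hc ha hβ hb hz (fun x hx => by
      rw [hin, hin]
      refine mul_le_mul_of_nonneg_left ?_ (inv_nonneg.2 hα.le)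
      simpa [inner_sub_right] using hvar x hx)
  rw [hST] at hy
  refine ⟨y, z, α⁻¹ • T.symm (T.symm y), γ, hyz, by rw [hST, hy], hz, ?_, hγ, ?_, hzγ⟩
  · rw [dualNorm_covNorm hT hST, map_smul, T.apply_symm_apply, norm_smul, hy, norm_inv,
      Real.norm_of_nonneg hα.le, inv_mul_cancel₀ hα.ne', EReal.coe_one]
  · rw [hin, real_inner_self_eq_norm_sq, hy]
    field_simp

theorem alphaStar_nonneg (hST : ∀ y, covNorm S y = ‖T.symm y‖)
    (hc : Convex ℝ B) (ha : Absorbent ℝ B) (hβ : 0 ≤ β) : 0 ≤ alphaStar S B β μ := by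
  obtain ⟨y, z, hyz, hy, hz, hvar⟩ :=
    (isLeast_alphaStar_and_exists_optimal (μ := μ) hST hc ha hβ).2
  rw [← hy, hST]
  exact norm_nonneg _

theorem exists_isDualCertificate (hT : ∀ x y, inner ℝ (T x) y = inner ℝ x (T y))
    (hST : ∀ y, covNorm S y = ‖T.symm y‖) (hcl : IsClosed B) (hc : Convex ℝ B)
    (ha : Absorbent ℝ B) (hβ : 0 ≤ β) (hb : β = 0 → Bornology.IsBounded B) :
    ∃ w, IsDualCertificate S B β μ w := by
  rcases (alphaStar_nonneg (μ := μ) hST hc ha hβ).eq_or_lt with hα | hα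
  · obtain ⟨y, z, hyz, hy, hz, -⟩ :=
      (isLeast_alphaStar_and_exists_optimal (μ := μ) hST hc ha hβ).2
    refine ⟨0, y, z, 0, hyz, hy, hz, ?_, ?_, ?_, ?_⟩
    · rw [dualNorm_covNorm hT hST]
      simp
    · rw [dualNorm_eq_of_isMaxOn (z := 0)] <;> simp
    · rw [inner_zero_left, hα]
    · simp
  · obtain ⟨y, z, w, γ, h1, h2, h3, h4, h⟩ :=
      exists_certificate_of_alphaStar_pos hT hST hcl hc ha hβ hb hα
    exact ⟨w, y, z, γ, h1, h2, h3, h4.le, h⟩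

/-- A point of the boundary of `β B` has a supporting hyperplane. -/
theorem exists_supporting_of_gauge_eq (hd : 0 < d) (hc : Convex ℝ B)
    (ha : Absorbent ℝ B) (hb : β = 0 → Bornology.IsBounded B)
    {z : EuclideanSpace ℝ (Fin d)} (hz : gauge B z = β) :
    ∃ w : EuclideanSpace ℝ (Fin d), w ≠ 0 ∧ ∀ x, gauge B x ≤ β → inner ℝ w x ≤ inner ℝ w z := by
  have hβ : 0 ≤ β := hz ▸ gauge_nonneg z
  rcases hβ.eq_or_lt with h0 | hpos
  · have : Nonempty (Fin d) := ⟨⟨0, hd⟩⟩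
    obtain ⟨w, hw⟩ := exists_ne (0 : EuclideanSpace ℝ (Fin d))
    refine ⟨w, hw, fun x hx => ?_⟩
    rw [← h0] at hx hz
    rw [eq_zero_of_gauge_le_zero ha (hb h0.symm) hx,
      eq_zero_of_gauge_le_zero ha (hb h0.symm) hz.le]
  · have hcont := continuous_gauge_of_absorbent hc ha
    have hopen : IsOpen {x | gauge B x < β} := isOpen_lt hcont continuous_const
    have hconv : Convex ℝ {x | gauge B x < β} := by
      simpa using (convexOn_gauge hc ha).convex_lt β
    obtain ⟨f, hf⟩ := geometric_hahn_banach_open_point hconv hopen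
      (x := z) (by simp [hz])
    set w := (InnerProductSpace.toDual ℝ (EuclideanSpace ℝ (Fin d))).symm f with hw
    have hwf : ∀ x, inner ℝ w x = f x := fun x => by
      rw [hw, InnerProductSpace.toDual_symm_apply]
    refine ⟨w, ?_, fun x hx => ?_⟩
    · intro h
      have h1 := hf 0 (by simpa using hpos)
      rw [← hwf, ← hwf, h] at h1
      simp at h1
    · rw [hwf, hwf]
      -- The separation concerns only the open ball; `r • x` lies in it for `r < 1`, and `r → 1`
      -- reaches the closed ball.
      have key : ∀ r ∈ Set.Ioo (0 : ℝ) 1, r * f x ≤ f z := by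
        intro r hr
        have := hf (r • x) (by
          change gauge B (r • x) < β
          rw [gauge_smul_of_nonneg hr.1.le, smul_eq_mul]
          nlinarith [hr.1, hr.2])
        simpa using this.le
      have hlim : Filter.Tendsto (fun r : ℝ => r * f x) (nhdsWithin 1 (Set.Iio 1))
          (nhds (1 * f x)) :=
        ((continuous_id.mul continuous_const).tendsto 1).mono_left nhdsWithin_le_nhds
      rw [one_mul] at hlim
      refine le_of_tendsto hlim ?_
      filter_upwards [Ioo_mem_nhdsLT (zero_lt_one' ℝ)] with r hr using key r hr

/-- If `α* = 0`, then `z = μ`, which `β ≤ gauge B μ` puts on the boundary of the ball, and a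
normalised supporting functional serves as `w`. If `α* > 0`, the constraint on `z` is tight
automatically. -/
theorem exists_certificate_of_le_gauge (hT : ∀ x y, inner ℝ (T x) y = inner ℝ x (T y))
    (hST : ∀ y, covNorm S y = ‖T.symm y‖) (hcl : IsClosed B) (hc : Convex ℝ B)
    (ha : Absorbent ℝ B) (hβ : 0 ≤ β) (hb : β = 0 → Bornology.IsBounded B)
    (hd : 0 < d) (hμ : β ≤ gauge B μ) :
    ∃ (y z w : EuclideanSpace ℝ (Fin d)) (γ : ℝ), y + z = μ ∧
      covNorm S y = alphaStar S B β μ ∧ gauge B z = β ∧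
      dualNorm (covNorm S) w = 1 ∧ dualNorm (gauge B) w = (γ : EReal) ∧
      inner ℝ w y = alphaStar S B β μ ∧ inner ℝ w z = β * γ := by
  rcases (alphaStar_nonneg (μ := μ) hST hc ha hβ).eq_or_lt with hα | hα
  · obtain ⟨y, z, hyz, hy, hz, -⟩ :=
      (isLeast_alphaStar_and_exists_optimal (μ := μ) hST hc ha hβ).2
    have hy0 : y = 0 := by
      rw [hST, ← hα, norm_eq_zero] at hy
      simpa using hy
    subst hy0
    rw [zero_add] at hyz
    have hzβ : gauge B z = β := le_antisymm hz (hyz ▸ hμ)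
    obtain ⟨w₀, hw₀, hmax⟩ := exists_supporting_of_gauge_eq hd hc ha hb hzβ
    have hn : 0 < ‖T w₀‖ := norm_pos_iff.2 (by simpa using hw₀)
    obtain ⟨γ, hγ, hzγ⟩ := exists_dualNorm_gauge_eq_of_isMaxOn (w := ‖T w₀‖⁻¹ • w₀)
      hcl hc ha hβ hb hz (fun x hx => by
        rw [real_inner_smul_left, real_inner_smul_left]
        exact mul_le_mul_of_nonneg_left (hmax x hx) (inv_nonneg.2 hn.le))
    refine ⟨0, z, ‖T w₀‖⁻¹ • w₀, γ, by simpa using hyz, hy, hzβ, ?_, hγ, ?_, hzγ⟩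
    · rw [dualNorm_covNorm hT hST, map_smul, norm_smul, norm_inv, norm_norm,
        inv_mul_cancel₀ hn.ne', EReal.coe_one]
    · rw [inner_zero_right, hα]
  · obtain ⟨y, z, w, γ, h1, h2, h3, h4, h5, h6, h7⟩ :=
      exists_certificate_of_alphaStar_pos hT hST hcl hc ha hβ hb hα
    refine ⟨y, z, w, γ, h1, h2, ?_, h4, h5, h6, h7⟩
    by_contra hne
    -- With slack in the constraint, `z + ε y` stays in the ball for small `ε > 0`, but there `w`
    -- takes the value `β γ + ε α*`, above its maximum.
    have hlt : gauge B z < β := lt_of_le_of_ne h3 hne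
    have hlim : Filter.Tendsto (fun ε : ℝ => gauge B (z + ε • y)) (nhdsWithin 0 (Set.Ioi 0))
        (nhds (gauge B (z + (0 : ℝ) • y))) :=
      (((continuous_gauge_of_absorbent hc ha).comp (by fun_prop :
        Continuous fun ε : ℝ => z + ε • y)).tendsto 0).mono_left nhdsWithin_le_nhds
    rw [zero_smul, add_zero] at hlim
    obtain ⟨ε, hε, hε0⟩ :=
      ((hlim.eventually (gt_mem_nhds hlt)).and self_mem_nhdsWithin).exists
    have := inner_le_mul_of_dualNorm_gauge_eq ha hβ hb h5 hε.le
    rw [inner_add_right, inner_smul_right, h6, h7] at this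
    have : 0 < ε * alphaStar S B β μ := mul_pos hε0 hα
    linarith

end Program

/-! ### Couplings -/

theorem map_prodMap_mem_couplings {X Y X' Y' : Type*} [MeasurableSpace X] [MeasurableSpace Y]
    [MeasurableSpace X'] [MeasurableSpace Y'] {P : Measure X} {Q : Measure Y} {f : X → X'}
    {g : Y → Y'} {π : Measure (X × Y)} (hπ : π ∈ couplings P Q) (hf : Measurable f)
    (hg : Measurable g) : π.map (Prod.map f g) ∈ couplings (P.map f) (Q.map g) := by
  obtain ⟨rfl, rfl⟩ := hπ
  constructor
  · rw [Measure.map_map measurable_fst (hf.prodMap hg), Measure.map_map hf measurable_fst]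
    rfl
  · rw [Measure.map_map measurable_snd (hf.prodMap hg), Measure.map_map hg measurable_snd]
    rfl

/-! ### Tails of the standard normal law -/

theorem gaussianReal_Ioi_eq (t : ℝ) :
    gaussianReal 0 1 (Set.Ioi t) = ENNReal.ofReal (gaussianQ t) := by
  rw [gaussianQ, ofReal_measureReal]

instance nullSingletonClass_gaussianReal_one (c : ℝ) :
    NullSingletonClass (gaussianReal c 1) :=
  nullSingletonClass_gaussianReal one_ne_zero

theorem gaussianReal_Iic_neg_eq (t : ℝ) :
    gaussianReal 0 1 (Set.Iic (-t)) = ENNReal.ofReal (gaussianQ t) := by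
  have h : gaussianReal 0 1 = (gaussianReal 0 1).map (fun x => -x) := by
    rw [gaussianReal_map_neg, neg_zero]
  rw [h, Measure.map_apply measurable_neg measurableSet_Iic, ← gaussianReal_Ioi_eq,
    ← measure_congr Ioi_ae_eq_Ici.symm]
  congr 1
  ext x
  simp

theorem gaussianReal_neg_Ioi_zero (a : ℝ) :
    gaussianReal (-a) 1 (Set.Ioi 0) = ENNReal.ofReal (gaussianQ a) := by
  have h : gaussianReal (-a) 1 = (gaussianReal 0 1).map (fun x => x + -a) := by
    rw [gaussianReal_map_add_const, zero_add]
  rw [h, Measure.map_apply (by fun_prop) measurableSet_Ioi, ← gaussianReal_Ioi_eq]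
  congr 1
  ext x
  simp

theorem gaussianReal_Iic_zero (a : ℝ) :
    gaussianReal a 1 (Set.Iic 0) = ENNReal.ofReal (gaussianQ a) := by
  have h : gaussianReal a 1 = (gaussianReal 0 1).map (fun x => x + a) := by
    rw [gaussianReal_map_add_const, zero_add]
  rw [h, Measure.map_apply (by fun_prop) measurableSet_Iic, ← gaussianReal_Iic_neg_eq]
  congr 1
  ext x
  simp only [Set.mem_preimage, Set.mem_Iic]
  constructor <;> intro h <;> linarith

theorem gaussianQ_nonneg (t : ℝ) : 0 ≤ gaussianQ t := measureReal_nonneg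

theorem gaussianQ_zero : gaussianQ 0 = 2⁻¹ := by
  have h1 := gaussianReal_Ioi_eq 0
  have h2 := gaussianReal_Iic_neg_eq 0
  have h3 := prob_add_prob_compl (μ := gaussianReal 0 1) (measurableSet_Ioi (a := (0 : ℝ)))
  rw [neg_zero] at h2
  rw [Set.compl_Ioi, h1, h2, ← ENNReal.ofReal_add (gaussianQ_nonneg 0) (gaussianQ_nonneg 0),
    ENNReal.ofReal_eq_one] at h3
  linarith

theorem gaussianQ_le_half {t : ℝ} (ht : 0 ≤ t) : gaussianQ t ≤ 2⁻¹ := by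
  rw [← gaussianQ_zero]
  exact measureReal_mono (Set.Ioi_subset_Ioi ht)

/-! ### The maximal coupling of two opposite normal laws -/

theorem gaussianReal_neg_restrict_Ioi_le {a : ℝ} (ha : 0 ≤ a) :
    (gaussianReal (-a) 1).restrict (Set.Ioi 0) ≤ (gaussianReal a 1).restrict (Set.Ioi 0) := by
  rw [gaussianReal_of_var_ne_zero _ one_ne_zero, gaussianReal_of_var_ne_zero _ one_ne_zero,
    restrict_withDensity measurableSet_Ioi, restrict_withDensity measurableSet_Ioi]
  refine withDensity_mono ((ae_restrict_iff' measurableSet_Ioi).2 (.of_forall fun x hx => ?_))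
  rw [gaussianPDF, gaussianPDF]
  refine ENNReal.ofReal_le_ofReal ?_
  rw [gaussianPDFReal, gaussianPDFReal]
  gcongr ?_ * Real.exp (?_ / _)
  have : 0 ≤ a * x := mul_nonneg ha (le_of_lt hx)
  nlinarith

theorem map_neg_gaussianReal_restrict_Ioi (a : ℝ) :
    ((gaussianReal a 1).restrict (Set.Ioi 0)).map (fun x => -x) =
      (gaussianReal (-a) 1).restrict (Set.Iic 0) := by
  rw [← Measure.restrict_congr_set Iio_ae_eq_Iic, ← gaussianReal_map_neg,
    Measure.restrict_map measurable_neg measurableSet_Iio]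
  congr 2
  ext x
  simp

/-- The common part of the two laws stays on the diagonal: the law of mean `-a` to the right of `0`
and that of mean `a` to the left. The excess `D` of mean `a` on the right is sent to its mirror
image, which is exactly what the other law still lacks. -/
theorem exists_coupling_gaussianReal {a : ℝ} (ha : 0 ≤ a) :
    ∃ π ∈ couplings (gaussianReal a 1) (gaussianReal (-a) 1),
      π {p | p.1 ≠ p.2} ≤ ENNReal.ofReal (1 - 2 * gaussianQ a) := by
  set PH := (gaussianReal a 1).restrict (Set.Ioi 0) with hPH
  set PL := (gaussianReal a 1).restrict (Set.Iic 0) with hPL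
  set QH := (gaussianReal (-a) 1).restrict (Set.Ioi 0) with hQH
  set QL := (gaussianReal (-a) 1).restrict (Set.Iic 0) with hQL
  have hle : QH ≤ PH := gaussianReal_neg_restrict_Ioi_le ha
  set D := PH - QH with hD
  have hDQ : D + QH = PH := Measure.sub_add_cancel_of_le hle
  have hP : PH + PL = gaussianReal a 1 := by
    rw [hPH, hPL, ← Set.compl_Ioi, Measure.restrict_add_restrict_compl measurableSet_Ioi]
  have hQ : QH + QL = gaussianReal (-a) 1 := by
    rw [hQH, hQL, ← Set.compl_Ioi, Measure.restrict_add_restrict_compl measurableSet_Ioi]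
  have hDL : D.map (fun x => -x) + PL = QL := by
    have h := congrArg (Measure.map (fun x : ℝ => -x)) hDQ
    rw [Measure.map_add _ _ measurable_neg, hPH, hQH, map_neg_gaussianReal_restrict_Ioi,
      map_neg_gaussianReal_restrict_Ioi, neg_neg] at h
    exact h
  have hmd : Measurable fun x : ℝ => (x, x) := by fun_prop
  have hmn : Measurable fun x : ℝ => (x, -x) := by fun_prop
  have hfd : Prod.fst ∘ (fun x : ℝ => (x, x)) = id := rfl
  have hfn : Prod.fst ∘ (fun x : ℝ => (x, -x)) = id := rfl
  have hsd : Prod.snd ∘ (fun x : ℝ => (x, x)) = id := rfl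
  have hsn : Prod.snd ∘ (fun x : ℝ => (x, -x)) = fun x => -x := rfl
  refine ⟨(QH + PL).map (fun x => (x, x)) + D.map (fun x => (x, -x)), ⟨?_, ?_⟩, ?_⟩
  · rw [Measure.map_add _ _ measurable_fst, Measure.map_map measurable_fst hmd,
      Measure.map_map measurable_fst hmn, hfd, hfn, Measure.map_id, Measure.map_id, ← hP, ← hDQ]
    abel
  · rw [Measure.map_add _ _ measurable_snd, Measure.map_map measurable_snd hmd,
      Measure.map_map measurable_snd hmn, hsd, hsn, Measure.map_id, ← hQ, ← hDL]
    abel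
  · have hms : MeasurableSet {p : ℝ × ℝ | p.1 ≠ p.2} :=
      (measurableSet_eq_fun measurable_fst measurable_snd).compl
    rw [Measure.add_apply, Measure.map_apply hmd hms, Measure.map_apply hmn hms]
    have h0 : (fun x : ℝ => (x, x)) ⁻¹' {p : ℝ × ℝ | p.1 ≠ p.2} = ∅ := by
      ext x
      simp
    rw [h0, measure_empty, zero_add]
    -- Only `D` is moved, and its mass is `(1 - Q(a)) - Q(a)`.
    refine (measure_mono (Set.subset_univ _)).trans ?_
    rw [hD, Measure.sub_apply MeasurableSet.univ hle, hPH, hQH, Measure.restrict_apply_univ,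
      Measure.restrict_apply_univ, gaussianReal_neg_Ioi_zero, ← Set.compl_Iic,
      prob_compl_eq_one_sub measurableSet_Iic, gaussianReal_Iic_zero, ← ENNReal.ofReal_one,
      ← ENNReal.ofReal_sub _ (gaussianQ_nonneg a), ← ENNReal.ofReal_sub _ (gaussianQ_nonneg a)]
    exact ENNReal.ofReal_le_ofReal (by linarith)

/-! ### Standard Gaussian vectors: coupling of translates and half-spaces -/

section StdGaussian

variable {E : Type*} [NormedAddCommGroup E] [InnerProductSpace ℝ E] [FiniteDimensional ℝ E]
  [MeasurableSpace E] [BorelSpace E]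

/-- Replacing the component of a standard Gaussian vector along `e` by an independent normal
variable with mean `c` shifts its law by `c e`. -/
theorem map_gaussianReal_prod_stdGaussian {e : E} (he : e = 0 ∨ ‖e‖ = 1) (c : ℝ) :
    ((gaussianReal c 1).prod (stdGaussian E)).map
        (fun p => p.1 • e + (p.2 - (inner ℝ e p.2 : ℝ) • e)) =
      (stdGaussian E).map (fun x => c • e + x) := by
  have : IsFiniteMeasure ((stdGaussian E).map (fun x => c • e + x)) :=
    Measure.isFiniteMeasure_map _ _
  apply Measure.ext_of_charFun
  ext t
  rw [charFun_map_const_add, charFun_stdGaussian, charFun_apply,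
    integral_map (Measurable.aemeasurable (by fun_prop))
      (Measurable.aestronglyMeasurable (by fun_prop))]
  -- Subtracting the component along `e` is self-adjoint, so it can act on `t` instead, and the
  -- exponential factors over the product measure.
  have hsplit : ∀ p : ℝ × E,
      Complex.exp (((inner ℝ (p.1 • e + (p.2 - (inner ℝ e p.2 : ℝ) • e)) t : ℝ) : ℂ) *
        Complex.I) =
      Complex.exp (((inner ℝ e t : ℝ) : ℂ) * (p.1 : ℂ) * Complex.I) *
        Complex.exp (((inner ℝ p.2 (t - (inner ℝ e t : ℝ) • e) : ℝ) : ℂ) * Complex.I) := by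
    intro p
    rw [← Complex.exp_add, ← add_mul]
    congr 2
    rw [inner_add_left, inner_sub_left, inner_sub_right, real_inner_smul_left,
      real_inner_smul_left, inner_smul_right, real_inner_comm p.2 e]
    push_cast
    ring
  simp_rw [hsplit]
  rw [integral_prod_mul (f := fun s : ℝ =>
      Complex.exp (((inner ℝ e t : ℝ) : ℂ) * (s : ℂ) * Complex.I))
    (g := fun x : E =>
      Complex.exp (((inner ℝ x (t - (inner ℝ e t : ℝ) • e) : ℝ) : ℂ) * Complex.I)),
    ← charFun_apply_real, ← charFun_apply, charFun_gaussianReal, charFun_stdGaussian,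
    ← Complex.exp_add, ← Complex.exp_add]
  congr 1
  have hn : ‖t - (inner ℝ e t : ℝ) • e‖ ^ 2 + (inner ℝ e t : ℝ) ^ 2 = ‖t‖ ^ 2 := by
    rw [norm_sub_sq_real, norm_smul, inner_smul_right, real_inner_comm e t, mul_pow,
      Real.norm_eq_abs, sq_abs]
    rcases he with rfl | he
    · simp
    · rw [he]
      ring
  rw [← Complex.ofReal_pow ‖t‖, ← hn, real_inner_smul_left]
  push_cast
  ring

/-- The two laws differ only along `v`: the components in that direction are coupled on the line and
the orthogonal part is shared. For `v = 0` the direction `e` is `0`. -/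
theorem exists_coupling_stdGaussian (v : E) :
    ∃ π ∈ couplings ((stdGaussian E).map (fun x => v + x)) ((stdGaussian E).map (fun x => -v + x)),
      π {p | p.1 ≠ p.2} ≤ ENNReal.ofReal (1 - 2 * gaussianQ ‖v‖) := by
  obtain ⟨ρ, ⟨hρ1, hρ2⟩, hρ⟩ := exists_coupling_gaussianReal (norm_nonneg v)
  set e : E := ‖v‖⁻¹ • v with he
  have he1 : e = 0 ∨ ‖e‖ = 1 := by
    by_cases hv : v = 0
    · exact .inl (by simp [he, hv])
    · exact .inr (norm_smul_inv_norm (𝕜 := ℝ) hv)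
  have hve : ‖v‖ • e = v := by
    by_cases hv : v = 0
    · simp [hv]
    · rw [he, smul_inv_smul₀ (norm_ne_zero_iff.2 hv)]
  have hve' : (-‖v‖) • e = -v := by rw [neg_smul, hve]
  have hfin : IsFiniteMeasure ρ := by
    refine ⟨?_⟩
    have h : ρ.map Prod.fst Set.univ = 1 := by rw [hρ1, measure_univ]
    rw [Measure.map_apply measurable_fst MeasurableSet.univ, Set.preimage_univ] at h
    simp [h]
  let G : ℝ × E → E := fun p => p.1 • e + (p.2 - (inner ℝ e p.2 : ℝ) • e)
  have hG : Measurable G := by fun_prop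
  let F : (ℝ × ℝ) × E → E × E := fun q => (G (q.1.1, q.2), G (q.1.2, q.2))
  have hF : Measurable F := by fun_prop
  refine ⟨(ρ.prod (stdGaussian E)).map F, ⟨?_, ?_⟩, ?_⟩
  · rw [Measure.map_map measurable_fst hF]
    have : Prod.fst ∘ F = G ∘ Prod.map Prod.fst id := rfl
    rw [this, ← Measure.map_map hG (measurable_fst.prodMap measurable_id),
      ← Measure.map_prod_map _ _ measurable_fst measurable_id, hρ1, Measure.map_id,
      map_gaussianReal_prod_stdGaussian he1, hve]
  · rw [Measure.map_map measurable_snd hF]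
    have : Prod.snd ∘ F = G ∘ Prod.map Prod.snd id := rfl
    rw [this, ← Measure.map_map hG (measurable_snd.prodMap measurable_id),
      ← Measure.map_prod_map _ _ measurable_snd measurable_id, hρ2, Measure.map_id,
      map_gaussianReal_prod_stdGaussian he1, hve']
  · have hms : MeasurableSet {p : E × E | p.1 ≠ p.2} :=
      (measurableSet_eq_fun measurable_fst measurable_snd).compl
    rw [Measure.map_apply hF hms]
    refine le_trans (measure_mono (t := {p : ℝ × ℝ | p.1 ≠ p.2} ×ˢ Set.univ) ?_) ?_
    · rintro ⟨⟨s, s'⟩, x⟩ hx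
      refine ⟨fun h => hx ?_, trivial⟩
      change s = s' at h
      subst h
      rfl
    · rw [Measure.prod_prod, measure_univ, mul_one]
      exact hρ

theorem map_inner_stdGaussian {e : E} (he : ‖e‖ = 1) :
    (stdGaussian E).map (fun x => (inner ℝ e x : ℝ)) = gaussianReal 0 1 := by
  apply Measure.ext_of_charFun
  ext t
  have h := charFun_map_eq_charFunDual_smul (μ := stdGaussian E) (innerSL ℝ e) t
  rw [charFunDual_stdGaussian, norm_smul, innerSL_apply_norm, he, mul_one, Real.norm_eq_abs,
    ← Complex.ofReal_pow, sq_abs] at h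
  rw [charFun_gaussianReal]
  refine Eq.trans h ?_
  congr 1
  push_cast
  ring

/-- Normalising `u` turns the threshold into `-a / ‖u‖ ≤ -a`. For `u = 0` and `a = 0` the event
would be everything, against the bound `1/2`. -/
theorem stdGaussian_halfSpace_le {u : E} (hu0 : u ≠ 0) (hu1 : ‖u‖ ≤ 1) {a : ℝ} (ha : 0 ≤ a) :
    stdGaussian E {x | a + inner ℝ u x ≤ 0} ≤ ENNReal.ofReal (gaussianQ a) := by
  have hpos : 0 < ‖u‖ := norm_pos_iff.2 hu0
  rw [← gaussianReal_Iic_neg_eq, ← map_inner_stdGaussian (norm_smul_inv_norm (𝕜 := ℝ) hu0),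
    Measure.map_apply (by fun_prop) measurableSet_Iic]
  refine measure_mono fun x (hx : a + inner ℝ u x ≤ 0) => ?_
  change inner ℝ (‖u‖⁻¹ • u) x ≤ -a
  rw [real_inner_smul_left, inv_mul_le_iff₀ hpos]
  nlinarith

end StdGaussian

/-! ### Transfer to covariance `S` through the square root -/

section MultivariateGaussian

variable {d : ℕ} {S : Matrix (Fin d) (Fin d) ℝ}
  {T : EuclideanSpace ℝ (Fin d) ≃L[ℝ] EuclideanSpace ℝ (Fin d)}

theorem map_const_add_multivariateGaussian (m z : EuclideanSpace ℝ (Fin d)) :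
    (multivariateGaussian m S).map (fun x => z + x) = multivariateGaussian (z + m) S := by
  rw [multivariateGaussian, multivariateGaussian, Measure.map_map (by fun_prop) (by fun_prop)]
  congr 1
  ext1 x
  simp [add_assoc]

theorem exists_coupling_multivariateGaussian (hST : ∀ y, covNorm S y = ‖T.symm y‖)
    (hlaw : ∀ m, multivariateGaussian m S =
      (stdGaussian (EuclideanSpace ℝ (Fin d))).map (fun x => m + T x))
    (y : EuclideanSpace ℝ (Fin d)) :
    ∃ π ∈ couplings (multivariateGaussian y S) (multivariateGaussian (-y) S),
      π {p | p.1 ≠ p.2} ≤ ENNReal.ofReal (1 - 2 * gaussianQ (covNorm S y)) := by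
  obtain ⟨ρ, hρ, hle⟩ := exists_coupling_stdGaussian (T.symm y)
  have hT : Measurable T := T.continuous.measurable
  refine ⟨ρ.map (Prod.map T T), ?_, ?_⟩
  · have h := map_prodMap_mem_couplings hρ hT hT
    rw [Measure.map_map hT (by fun_prop), Measure.map_map hT (by fun_prop)] at h
    rw [hlaw, hlaw]
    convert h using 3
    · ext1 x
      simp
    · ext1 x
      simp
  · have hms : MeasurableSet {p : EuclideanSpace ℝ (Fin d) × EuclideanSpace ℝ (Fin d) |
        p.1 ≠ p.2} := (measurableSet_eq_fun measurable_fst measurable_snd).compl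
    rw [Measure.map_apply (hT.prodMap hT) hms, hST]
    refine le_trans (measure_mono ?_) hle
    rintro ⟨x, x'⟩ h heq
    exact h (congrArg T heq)

theorem multivariateGaussian_halfSpace_le (hT : ∀ x y, inner ℝ (T x) y = inner ℝ x (T y))
    (hlaw : ∀ m, multivariateGaussian m S =
      (stdGaussian (EuclideanSpace ℝ (Fin d))).map (fun x => m + T x))
    {m w : EuclideanSpace ℝ (Fin d)} (hw0 : w ≠ 0) (hw1 : ‖T w‖ ≤ 1) {a c : ℝ} (ha : 0 ≤ a)
    (hm : inner ℝ w m = a + c) :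
    multivariateGaussian m S {x | inner ℝ w x ≤ c} ≤ ENNReal.ofReal (gaussianQ a) := by
  have hms : MeasurableSet {x : EuclideanSpace ℝ (Fin d) | inner ℝ w x ≤ c} :=
    measurableSet_le (by fun_prop) measurable_const
  rw [hlaw, Measure.map_apply (by fun_prop) hms]
  refine le_trans (measure_mono fun x hx => ?_)
    (stdGaussian_halfSpace_le (u := T w) (by simpa using hw0) hw1 ha)
  change inner ℝ w (m + T x) ≤ c at hx
  rw [inner_add_right, hm, ← hT] at hx
  change a + inner ℝ (T w) x ≤ 0
  linarith

end MultivariateGaussian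

/-! ### Costs and losses -/

section Cost

variable {X X' : Type*} {N : X → Set X'}

/-- An intermediate point in either neighborhood saves one of the two unit costs; if both were
empty, the composed cost would exceed `1`. -/
theorem costComp_advCost_le_one (x x' : X) (h : (N x ∪ N x').Nonempty) :
    costComp (advCost N) (fun x' x => advCost N x x') x x' ≤ 1 := by
  obtain ⟨y, hy | hy⟩ := h
  · refine (iInf_le _ y).trans ?_
    simp only [advCost, if_pos hy, zero_add]
    split_ifs <;> simp
  · refine (iInf_le _ y).trans ?_
    simp only [advCost, if_pos hy, add_zero]
    split_ifs <;> simp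

theorem costComp_advCost_eq_zero {x x' : X} {y : X'} (hy : y ∈ N x) (hy' : y ∈ N x') :
    costComp (advCost N) (fun x' x => advCost N x x') x x' = 0 :=
  le_antisymm ((iInf_le _ y).trans (by simp [advCost, hy, hy'])) zero_le

theorem one_le_costComp_advCost {x x' : X} (h : Disjoint (N x) (N x')) :
    1 ≤ costComp (advCost N) (fun x' x => advCost N x x') x x' := by
  refine le_iInf fun y => ?_
  by_cases hy : y ∈ N x
  · simp [advCost, Set.disjoint_left.1 h hy]
  · simp [advCost, hy]

end Cost

theorem zeroOneLoss_le_one (a b : ℤˣ) : zeroOneLoss a b ≤ 1 := by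
  unfold zeroOneLoss
  split_ifs <;> simp

/-- The two labels cannot both be predicted correctly at the same point. -/
theorem one_le_zeroOneLoss_add (a : ℤˣ) : 1 ≤ zeroOneLoss a 1 + zeroOneLoss a (-1) := by
  rcases Int.units_eq_one_or a with rfl | rfl <;> simp [zeroOneLoss]

theorem measurableSet_units_int (s : Set ℤˣ) : MeasurableSet s := by
  refine ⟨Units.val '' s, trivial, ?_⟩
  exact Set.preimage_image_eq _ Units.val_injective

instance : DiscreteMeasurableSpace ℤˣ := ⟨measurableSet_units_int⟩

/-! ### Transport cost and adversarial loss for the Gaussian classes -/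

section Loss

variable {d : ℕ} {S : Matrix (Fin d) (Fin d) ℝ} {B : Set (EuclideanSpace ℝ (Fin d))} {β : ℝ}
  {μ : EuclideanSpace ℝ (Fin d)} {T : EuclideanSpace ℝ (Fin d) ≃L[ℝ] EuclideanSpace ℝ (Fin d)}

theorem add_mem_ballNbhd {x z : EuclideanSpace ℝ (Fin d)} (hz : z ∈ β • B) :
    x + z ∈ ballNbhd B β x := ⟨z, hz, rfl⟩

theorem neg_mem_smul_of_symm (hs : ∀ z ∈ B, -z ∈ B) {z : EuclideanSpace ℝ (Fin d)}
    (hz : z ∈ β • B) : -z ∈ β • B := by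
  obtain ⟨b, hb, rfl⟩ := hz
  exact ⟨-b, hs b hb, by simp⟩

theorem advTransportCost_le (hST : ∀ y, covNorm S y = ‖T.symm y‖)
    (hlaw : ∀ m, multivariateGaussian m S =
      (stdGaussian (EuclideanSpace ℝ (Fin d))).map (fun x => m + T x))
    (hs : ∀ z ∈ B, -z ∈ B) {y z : EuclideanSpace ℝ (Fin d)} (hyz : y + z = μ)
    (hz : z ∈ β • B) :
    advTransportCost (ballNbhd B β) (multivariateGaussian μ S) (multivariateGaussian (-μ) S) ≤
      ENNReal.ofReal (1 - 2 * gaussianQ (covNorm S y)) := by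
  obtain ⟨π, hπ, hle⟩ := exists_coupling_multivariateGaussian hST hlaw y
  have h := map_prodMap_mem_couplings hπ (measurable_const_add z) (measurable_const_add (-z))
  rw [map_const_add_multivariateGaussian, map_const_add_multivariateGaussian, ← neg_add,
    add_comm z y, hyz] at h
  refine (iInf₂_le _ h).trans (le_trans ?_ hle)
  have hms : MeasurableSet {p : EuclideanSpace ℝ (Fin d) × EuclideanSpace ℝ (Fin d) |
      p.1 ≠ p.2} := (measurableSet_eq_fun measurable_fst measurable_snd).compl
  refine (lintegral_map_le _ _).trans ?_
  rw [← lintegral_indicator_one hms]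
  refine lintegral_mono fun p => ?_
  have h1 : p.1 ∈ ballNbhd B β (z + p.1) := by
    simpa using add_mem_ballNbhd (x := z + p.1) (neg_mem_smul_of_symm hs hz)
  by_cases hp : p.1 = p.2
  · have h2 : p.1 ∈ ballNbhd B β (-z + p.2) := by
      simpa [hp] using add_mem_ballNbhd (x := -z + p.2) hz
    exact (costComp_advCost_eq_zero h1 h2).trans_le zero_le
  · rw [Set.indicator_of_mem (by exact hp)]
    exact costComp_advCost_le_one _ _ ⟨_, .inl h1⟩

theorem le_advTransportCost (hT : ∀ x y, inner ℝ (T x) y = inner ℝ x (T y))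
    (hlaw : ∀ m, multivariateGaussian m S =
      (stdGaussian (EuclideanSpace ℝ (Fin d))).map (fun x => m + T x))
    {w : EuclideanSpace ℝ (Fin d)} (hw0 : w ≠ 0) (hw1 : ‖T w‖ ≤ 1) {a c : ℝ} (ha : 0 ≤ a)
    (hm : inner ℝ w μ = a + c) (hs : ∀ z ∈ B, -z ∈ B) (hB : ∀ z ∈ β • B, inner ℝ w z ≤ c) :
    ENNReal.ofReal (1 - 2 * gaussianQ a) ≤
      advTransportCost (ballNbhd B β) (multivariateGaussian μ S) (multivariateGaussian (-μ) S) := by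
  refine le_iInf₂ fun π hπ => ?_
  -- Off these half-spaces `w` is positive on the first neighborhood and negative on the second, so
  -- they are disjoint; a union bound suffices for any coupling.
  set U : Set (EuclideanSpace ℝ (Fin d)) := {x | inner ℝ w x ≤ c} with hU
  set V : Set (EuclideanSpace ℝ (Fin d)) := {x | inner ℝ (-w) x ≤ c} with hV
  have hUm : MeasurableSet U := measurableSet_le (by fun_prop) measurable_const
  have hVm : MeasurableSet V := measurableSet_le (by fun_prop) measurable_const
  have hUle := multivariateGaussian_halfSpace_le hT hlaw hw0 hw1 ha hm
  have hVle := multivariateGaussian_halfSpace_le (m := -μ) hT hlaw (neg_ne_zero.2 hw0)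
    (by rwa [map_neg, norm_neg]) ha (by rw [inner_neg_neg, hm])
  rw [← hπ.1, Measure.map_apply measurable_fst hUm] at hUle
  rw [← hπ.2, Measure.map_apply measurable_snd hVm] at hVle
  have hprob : π Set.univ = 1 := by
    have h : π.map Prod.fst Set.univ = 1 := by rw [hπ.1, measure_univ]
    rwa [Measure.map_apply measurable_fst MeasurableSet.univ, Set.preimage_univ] at h
  set W := Prod.fst ⁻¹' U ∪ Prod.snd ⁻¹' V with hW
  have hWm : MeasurableSet W := (measurable_fst hUm).union (measurable_snd hVm)
  have hWle : π W ≤ ENNReal.ofReal (2 * gaussianQ a) := by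
    refine (measure_union_le _ _).trans ((add_le_add hUle hVle).trans_eq ?_)
    rw [← ENNReal.ofReal_add (gaussianQ_nonneg a) (gaussianQ_nonneg a), two_mul]
  have hWc : ENNReal.ofReal (1 - 2 * gaussianQ a) ≤ π Wᶜ := by
    rw [ENNReal.ofReal_sub _ (by linarith [gaussianQ_nonneg a]), ENNReal.ofReal_one,
      tsub_le_iff_right, ← hprob, ← measure_add_measure_compl hWm, add_comm]
    gcongr
  refine hWc.trans ?_
  rw [← lintegral_indicator_one hWm.compl]
  refine lintegral_mono fun p => ?_
  by_cases hp : p ∈ W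
  · rw [Set.indicator_of_notMem (by simpa using hp)]
    exact zero_le
  · rw [Set.indicator_of_mem (by exact hp)]
    refine one_le_costComp_advCost (Set.disjoint_left.2 ?_)
    rintro _ ⟨b, hb, rfl⟩ ⟨b', hb', hbb⟩
    have h1 : ¬ inner ℝ w p.1 ≤ c := fun h => hp (.inl h)
    have h2 : ¬ inner ℝ (-w) p.2 ≤ c := fun h => hp (.inr h)
    have h3 := congrArg (inner ℝ w) hbb
    have h4 := hB _ (neg_mem_smul_of_symm hs hb)
    have h5 := hB _ hb'
    simp only [inner_add_right, inner_neg_right, inner_neg_left, not_le] at h1 h2 h3 h4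
    linarith

/-- Only an inequality is claimed: the supremum over a neighborhood need not be measurable, and the
lower integral can grow when pulled back along a map. -/
theorem advLoss_gaussianMixture_le (N : EuclideanSpace ℝ (Fin d) → Set (EuclideanSpace ℝ (Fin d)))
    {h : EuclideanSpace ℝ (Fin d) → ℤˣ} :
    advLoss N (gaussianMixture μ S) h ≤
      2⁻¹ * ∫⁻ x, ⨆ x' ∈ N x, zeroOneLoss (h x') 1 ∂(multivariateGaussian μ S) +
      2⁻¹ * ∫⁻ x, ⨆ x' ∈ N x, zeroOneLoss (h x') (-1) ∂(multivariateGaussian (-μ) S) := by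
  rw [advLoss, gaussianMixture, lintegral_add_measure, lintegral_smul_measure,
    lintegral_smul_measure, smul_eq_mul, smul_eq_mul]
  gcongr
  · exact lintegral_map_le _ _
  · exact lintegral_map_le _ _

theorem gaussianQ_le_advLoss (hST : ∀ y, covNorm S y = ‖T.symm y‖)
    (hlaw : ∀ m, multivariateGaussian m S =
      (stdGaussian (EuclideanSpace ℝ (Fin d))).map (fun x => m + T x))
    (hs : ∀ z ∈ B, -z ∈ B) {y z : EuclideanSpace ℝ (Fin d)} (hyz : y + z = μ)
    (hz : z ∈ β • B) {h : EuclideanSpace ℝ (Fin d) → ℤˣ} (hh : Measurable h) :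
    ENNReal.ofReal (gaussianQ (covNorm S y)) ≤
      advLoss (ballNbhd B β) (gaussianMixture μ S) h := by
  obtain ⟨π, hπ, hle⟩ := exists_coupling_multivariateGaussian hST hlaw y
  have hloss : Measurable fun q : ℤˣ × ℤˣ => zeroOneLoss q.1 q.2 := measurable_of_countable _
  have hsgn : Measurable fun q : EuclideanSpace ℝ (Fin d) × ℤˣ => q.1 - (q.2 : ℤ) • z := by
    have h1 : Measurable fun q : ℤˣ => (q : ℤ) • z := measurable_of_countable _
    exact measurable_fst.sub (h1.comp measurable_snd)
  have hg : Measurable fun q : EuclideanSpace ℝ (Fin d) × ℤˣ =>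
      zeroOneLoss (h (q.1 - (q.2 : ℤ) • z)) q.2 :=
    hloss.comp ((hh.comp hsgn).prodMk measurable_snd)
  -- The adversary that shifts each example by `z` against its label gives a measurable minorant of
  -- the loss and turns the class means into `±y`.
  have hminor : ∫⁻ q, zeroOneLoss (h (q.1 - (q.2 : ℤ) • z)) q.2 ∂(gaussianMixture μ S) ≤
      advLoss (ballNbhd B β) (gaussianMixture μ S) h := by
    refine lintegral_mono fun q => ?_
    refine le_iSup₂_of_le (q.1 - (q.2 : ℤ) • z) ?_ le_rfl
    rcases Int.units_eq_one_or q.2 with hq | hq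
    · simpa [hq, sub_eq_add_neg] using add_mem_ballNbhd (x := q.1) (neg_mem_smul_of_symm hs hz)
    · simpa [hq] using add_mem_ballNbhd (x := q.1) hz
  refine le_trans ?_ hminor
  have hl1 : Measurable fun x => zeroOneLoss (h x) 1 :=
    hloss.comp (hh.prodMk measurable_const)
  have hl2 : Measurable fun x => zeroOneLoss (h x) (-1) :=
    hloss.comp (hh.prodMk measurable_const)
  have e1 : ∫⁻ q, zeroOneLoss (h (q.1 - (q.2 : ℤ) • z)) q.2
      ∂((multivariateGaussian μ S).map (fun x => (x, (1 : ℤˣ)))) =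
      ∫⁻ p, zeroOneLoss (h p.1) 1 ∂π := by
    have hx : ∀ x, zeroOneLoss (h (z + x - ((1 : ℤˣ) : ℤ) • z)) 1 = zeroOneLoss (h x) 1 := by simp
    rw [← hyz, add_comm, ← map_const_add_multivariateGaussian,
      Measure.map_map (by fun_prop) (by fun_prop), lintegral_map hg (by fun_prop)]
    simp only [Function.comp_apply, hx]
    rw [← hπ.1, lintegral_map hl1 measurable_fst]
  have e2 : ∫⁻ q, zeroOneLoss (h (q.1 - (q.2 : ℤ) • z)) q.2
      ∂((multivariateGaussian (-μ) S).map (fun x => (x, (-1 : ℤˣ)))) =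
      ∫⁻ p, zeroOneLoss (h p.2) (-1) ∂π := by
    have hx : ∀ x, zeroOneLoss (h (-z + x - ((-1 : ℤˣ) : ℤ) • z)) (-1) =
        zeroOneLoss (h x) (-1) := by simp
    rw [← hyz, neg_add_rev, ← map_const_add_multivariateGaussian,
      Measure.map_map (by fun_prop) (by fun_prop), lintegral_map hg (by fun_prop)]
    simp only [Function.comp_apply, hx]
    rw [← hπ.2, lintegral_map hl2 measurable_snd]
  rw [gaussianMixture, lintegral_add_measure, lintegral_smul_measure, lintegral_smul_measure,
    e1, e2, smul_eq_mul, smul_eq_mul, ← mul_add,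
    ← lintegral_add_left (f := fun p : EuclideanSpace ℝ (Fin d) × EuclideanSpace ℝ (Fin d) =>
      zeroOneLoss (h p.1) 1) (hl1.comp measurable_fst)]
  have hprob : π Set.univ = 1 := by
    have h : π.map Prod.fst Set.univ = 1 := by rw [hπ.1, measure_univ]
    rwa [Measure.map_apply measurable_fst MeasurableSet.univ, Set.preimage_univ] at h
  have hms : MeasurableSet {p : EuclideanSpace ℝ (Fin d) × EuclideanSpace ℝ (Fin d) |
      p.1 ≠ p.2} := (measurableSet_eq_fun measurable_fst measurable_snd).compl
  have hα : 0 ≤ covNorm S y := by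
    rw [hST]
    exact norm_nonneg _
  have hlow : ENNReal.ofReal (2 * gaussianQ (covNorm S y)) ≤
      ∫⁻ p, (zeroOneLoss (h p.1) 1 + zeroOneLoss (h p.2) (-1)) ∂π := by
    have hc : ENNReal.ofReal (2 * gaussianQ (covNorm S y)) ≤
        π {p | p.1 ≠ p.2}ᶜ := by
      have h1 : (1 : ℝ≥0∞) ≤ π {p | p.1 ≠ p.2}ᶜ +
          ENNReal.ofReal (1 - 2 * gaussianQ (covNorm S y)) := by
        rw [← hprob, ← measure_add_measure_compl hms, add_comm]
        gcongr
      have h2 : ENNReal.ofReal (2 * gaussianQ (covNorm S y)) +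
          ENNReal.ofReal (1 - 2 * gaussianQ (covNorm S y)) = 1 := by
        rw [← ENNReal.ofReal_add (by linarith [gaussianQ_nonneg (covNorm S y)])
          (by linarith [gaussianQ_le_half hα])]
        simp
      rw [← h2] at h1
      exact (ENNReal.add_le_add_iff_right ENNReal.ofReal_ne_top).1 h1
    refine hc.trans ?_
    rw [← lintegral_indicator_one hms.compl]
    refine lintegral_mono fun p => ?_
    by_cases hp : p.1 = p.2
    · rw [Set.indicator_of_mem (by simpa using hp), hp]
      exact one_le_zeroOneLoss_add _
    · rw [Set.indicator_of_notMem (by simpa using hp)]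
      exact zero_le
  calc ENNReal.ofReal (gaussianQ (covNorm S y))
      = 2⁻¹ * ENNReal.ofReal (2 * gaussianQ (covNorm S y)) := by
        rw [ENNReal.ofReal_mul zero_le_two, ← mul_assoc]
        simp [ENNReal.inv_mul_cancel]
    _ ≤ _ := by gcongr

theorem measurable_linearClassifier (s : ℤˣ) (w : EuclideanSpace ℝ (Fin d)) :
    Measurable (linearClassifier s w) := by
  refine Measurable.ite (measurableSet_lt measurable_const (by fun_prop)) measurable_const
    (Measurable.ite (measurableSet_lt (by fun_prop) measurable_const) measurable_const
      measurable_const)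

theorem lintegral_iSup_zeroOneLoss_le {P : Measure (EuclideanSpace ℝ (Fin d))}
    {N : EuclideanSpace ℝ (Fin d) → Set (EuclideanSpace ℝ (Fin d))}
    {h : EuclideanSpace ℝ (Fin d) → ℤˣ} {b : ℤˣ} {U : Set (EuclideanSpace ℝ (Fin d))}
    (hUm : MeasurableSet U) (hU : ∀ x ∉ U, ∀ x' ∈ N x, h x' = b) :
    ∫⁻ x, ⨆ x' ∈ N x, zeroOneLoss (h x') b ∂P ≤ P U := by
  rw [← lintegral_indicator_one hUm]
  refine lintegral_mono fun x => iSup₂_le fun x' hx' => ?_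
  by_cases hx : x ∈ U
  · rw [Set.indicator_of_mem hx]
    exact zeroOneLoss_le_one _ _
  · rw [hU x hx x' hx']
    simp [zeroOneLoss]

theorem advLoss_linearClassifier_le (hT : ∀ x y, inner ℝ (T x) y = inner ℝ x (T y))
    (hlaw : ∀ m, multivariateGaussian m S =
      (stdGaussian (EuclideanSpace ℝ (Fin d))).map (fun x => m + T x))
    {w : EuclideanSpace ℝ (Fin d)} (hw0 : w ≠ 0) (hw1 : ‖T w‖ ≤ 1) {a c : ℝ} (ha : 0 ≤ a)
    (hm : inner ℝ w μ = a + c) (hs : ∀ z ∈ B, -z ∈ B) (hB : ∀ z ∈ β • B, inner ℝ w z ≤ c)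
    (s : ℤˣ) :
    advLoss (ballNbhd B β) (gaussianMixture μ S) (linearClassifier s w) ≤
      ENNReal.ofReal (gaussianQ a) := by
  have hUle := multivariateGaussian_halfSpace_le hT hlaw hw0 hw1 ha hm
  have hVle := multivariateGaussian_halfSpace_le (m := -μ) hT hlaw (neg_ne_zero.2 hw0)
    (by rwa [map_neg, norm_neg]) ha (by rw [inner_neg_neg, hm])
  refine (advLoss_gaussianMixture_le _).trans ?_
  have h1 := (lintegral_iSup_zeroOneLoss_le (N := ballNbhd B β) (h := linearClassifier s w)
    (b := 1) (P := multivariateGaussian μ S)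
    (measurableSet_le (by fun_prop) measurable_const) (fun x hx x' hx' => by
      obtain ⟨b, hb, rfl⟩ := hx'
      have h1 : ¬ inner ℝ w x ≤ c := hx
      have h4 := hB _ (neg_mem_smul_of_symm hs hb)
      rw [inner_neg_right] at h4
      have : 0 < inner ℝ w (x + b) := by
        rw [inner_add_right]
        linarith
      simp only [linearClassifier, if_pos this])).trans hUle
  have h2 := (lintegral_iSup_zeroOneLoss_le (N := ballNbhd B β) (h := linearClassifier s w)
    (b := -1) (P := multivariateGaussian (-μ) S)
    (measurableSet_le (by fun_prop) measurable_const) (fun x hx x' hx' => by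
      obtain ⟨b, hb, rfl⟩ := hx'
      have h1 : ¬ inner ℝ (-w) x ≤ c := hx
      have h4 := hB _ hb
      rw [inner_neg_left] at h1
      have : inner ℝ w (x + b) < 0 := by
        rw [inner_add_right]
        linarith
      simp only [linearClassifier, if_pos this, if_neg this.le.not_gt])).trans hVle
  refine (add_le_add (mul_le_mul_right h1 _) (mul_le_mul_right h2 _)).trans_eq ?_
  rw [← add_mul, ENNReal.inv_two_add_inv_two, one_mul]

/-- When `α* = 0`, the zero vector can be a certificate; its classifier is constant and errs on one
class only, matching `Q(0) = 1/2`. -/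
theorem advLoss_linearClassifier_zero_le (s : ℤˣ) :
    advLoss (ballNbhd B β) (gaussianMixture μ S) (linearClassifier s 0) ≤ 2⁻¹ := by
  refine (advLoss_gaussianMixture_le _).trans ?_
  have hconst : ∀ x : EuclideanSpace ℝ (Fin d), linearClassifier s 0 x = s := fun x => by
    simp [linearClassifier]
  simp_rw [hconst]
  have hle : ∀ (P : Measure (EuclideanSpace ℝ (Fin d))) [IsProbabilityMeasure P] (b : ℤˣ),
      ∫⁻ x, ⨆ x' ∈ ballNbhd B β x, zeroOneLoss s b ∂P ≤ zeroOneLoss s b := by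
    intro P _ b
    refine (lintegral_mono fun x => iSup₂_le fun _ _ => le_rfl).trans ?_
    simp
  refine (add_le_add (mul_le_mul_right (hle _ _) _) (mul_le_mul_right (hle _ _) _)).trans ?_
  rcases Int.units_eq_one_or s with rfl | rfl <;> simp [zeroOneLoss]

end Loss

theorem theorem2 (d : ℕ) (μ : EuclideanSpace ℝ (Fin d)) (S : Matrix (Fin d) (Fin d) ℝ)
    (hS : S.PosDef) (B : Set (EuclideanSpace ℝ (Fin d))) (hB_closed : IsClosed B)
    (hB_convex : Convex ℝ B) (hB_absorbent : Absorbent ℝ B) (hB_symm : ∀ z ∈ B, -z ∈ B)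
    (β : ℝ) (hβ : 0 ≤ β) (hβ_zero : β = 0 → Bornology.IsBounded B) :
    -- the minimum in the convex program is attained
    IsLeast (programValues S B β μ) (alphaStar S B β μ) ∧
    -- the adversarial transport cost
    advTransportCost (ballNbhd B β) (multivariateGaussian μ S) (multivariateGaussian (-μ) S) =
      ENNReal.ofReal (1 - 2 * gaussianQ (alphaStar S B β μ)) ∧
    -- the optimal adversarial loss over all measurable classifiers
    IsLeast {r : ℝ≥0∞ | ∃ h : EuclideanSpace ℝ (Fin d) → ℤˣ, Measurable h ∧
        r = advLoss (ballNbhd B β) (gaussianMixture μ S) h}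
      (ENNReal.ofReal (gaussianQ (alphaStar S B β μ))) ∧
    -- dual certificates exist
    (∃ w, IsDualCertificate S B β μ w) ∧
    -- with equality in all the constraints, as long as the budget is at most the norm of `μ`
    (0 < d → β ≤ gauge B μ →
      ∃ (y z w : EuclideanSpace ℝ (Fin d)) (γ : ℝ), y + z = μ ∧
        covNorm S y = alphaStar S B β μ ∧ gauge B z = β ∧
        dualNorm (covNorm S) w = 1 ∧ dualNorm (gauge B) w = (γ : EReal) ∧
        inner ℝ w y = alphaStar S B β μ ∧ inner ℝ w z = β * γ) ∧
    -- every dual certificate gives an optimal linear classifier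
    (∀ w, IsDualCertificate S B β μ w → ∀ s : ℤˣ,
      Measurable (linearClassifier s w) ∧
      advLoss (ballNbhd B β) (gaussianMixture μ S) (linearClassifier s w) =
        ENNReal.ofReal (gaussianQ (alphaStar S B β μ))) := by
  obtain ⟨T, hT, hST, hlaw⟩ := exists_sqrt_equiv hS
  obtain ⟨hleast, y, z, hyz, hy, hz, -⟩ :=
    isLeast_alphaStar_and_exists_optimal (μ := μ) hST hB_convex hB_absorbent hβ
  have hα := alphaStar_nonneg (μ := μ) hST hB_convex hB_absorbent hβ
  have hmem : ∀ x, gauge B x ≤ β ↔ x ∈ β • B := fun x =>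
    gauge_le_iff_mem_smul hB_closed hB_convex hB_absorbent hβ hβ_zero
  have hcert := exists_isDualCertificate (μ := μ) hT hST hB_closed hB_convex hB_absorbent hβ
    hβ_zero
  have hlower : ∀ h, Measurable h → ENNReal.ofReal (gaussianQ (alphaStar S B β μ)) ≤
      advLoss (ballNbhd B β) (gaussianMixture μ S) h := fun h hh => by
    rw [← hy]
    exact gaussianQ_le_advLoss hST hlaw hB_symm hyz ((hmem z).1 hz) hh
  -- What the upper bound on the loss and the lower bound on the cost need from a certificate, with
  -- `c = β γ`.
  have hsep : ∀ w, IsDualCertificate S B β μ w → ‖T w‖ ≤ 1 ∧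
      (w = 0 → alphaStar S B β μ = 0) ∧ ∃ c : ℝ, inner ℝ w μ = alphaStar S B β μ + c ∧
        ∀ x ∈ β • B, inner ℝ w x ≤ c := by
    rintro w ⟨y', z', γ, hyz', hy', hz', hw, hγ, hwy, hwz⟩
    refine ⟨?_, ?_, β * γ, ?_, fun x hx => ?_⟩
    · rw [dualNorm_covNorm hT hST] at hw
      exact_mod_cast hw
    · rintro rfl
      rw [← hwy, inner_zero_left]
    · exact (congrArg (inner ℝ w) hyz'.symm).trans (by rw [inner_add_right, hwy, hwz])
    · exact inner_le_mul_of_dualNorm_gauge_eq hB_absorbent hβ hβ_zero hγ ((hmem x).2 hx)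
  have hopt : ∀ w, IsDualCertificate S B β μ w → ∀ s : ℤˣ,
      Measurable (linearClassifier s w) ∧
      advLoss (ballNbhd B β) (gaussianMixture μ S) (linearClassifier s w) =
        ENNReal.ofReal (gaussianQ (alphaStar S B β μ)) := by
    intro w hw s
    obtain ⟨hw1, hw0, c, hwμ, hwB⟩ := hsep w hw
    refine ⟨measurable_linearClassifier s w,
      le_antisymm ?_ (hlower _ (measurable_linearClassifier s w))⟩
    by_cases h0 : w = 0
    · rw [hw0 h0, h0, gaussianQ_zero, ENNReal.ofReal_inv_of_pos zero_lt_two, ENNReal.ofReal_ofNat]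
      exact advLoss_linearClassifier_zero_le s
    · exact advLoss_linearClassifier_le hT hlaw h0 hw1 hα hwμ hB_symm hwB s
  refine ⟨hleast, le_antisymm ?_ ?_, ⟨?_, ?_⟩, hcert, ?_, hopt⟩
  · rw [← hy]
    exact advTransportCost_le hST hlaw hB_symm hyz ((hmem z).1 hz)
  · obtain ⟨w, hw⟩ := hcert
    obtain ⟨hw1, hw0, c, hwμ, hwB⟩ := hsep w hw
    by_cases h0 : w = 0
    · rw [hw0 h0, gaussianQ_zero]
      simp
    · exact le_advTransportCost hT hlaw h0 hw1 hα hwμ hB_symm hwB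
  · obtain ⟨w, hw⟩ := hcert
    exact ⟨_, (hopt w hw 1).1, (hopt w hw 1).2.symm⟩
  · rintro r ⟨h, hh, rfl⟩
    exact hlower h hh
  · exact fun hd hμ => exists_certificate_of_le_gauge hT hST hB_closed hB_convex hB_absorbent hβ
      hβ_zero hd hμ
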